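/- For a finite set $A\subset\mathbb{Z}$ and $m\in\mathbb{Z}$ let $r_A(m)=|\{(a_1,a_2)\in A\times A: m=a_1-a_2\}|$. For natural numbers $g,N$ call $A$ a $g$-difference set for $[N]=\{1,\dots,N\}$ if $r_A(m)\ge g$ for every $m\in[N]$, and let $\eta_g(N)$ be the minimum size of a $g$-difference set for $[N]$. Let $\mathcal F$ be the family of all Lebesgue measurable functions $f:\mathbb{R}\to\mathbb{R}_{\ge 0}$ such that $\int_{\mathbb{R}}f(t)f(x+t)\,dt\ge 1$ for all $x\in[0,1]$ (the value $+\infty$ being allowed for the integral), and let $\tau=\inf_{f\in\mathcal F}\int_{\mathbb{R}}f(x)\,dx$. Theorem. For every $0<\varepsilon<1$ there is $g_0=g_0(\varepsilon)$ such that for every integer $g\ge g_0$ there is $N_0=N_0(\varepsilon,g)$ such that for every integer $N\ge N_0$ $$\frac{\eta_g(N)}{\sqrt{gN}}\le\frac{(1+\varepsilon)^4}{1-\varepsilon}\,\tau .$$ Moreover, $$\limsup_{g\to\infty}\ \limsup_{N\to\infty}\ \frac{\eta_g(N)}{\sqrt{gN}}\le\tau .$$ -/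

import Mathlib

open scoped NNReal ENNReal

namespace DiffSet

/-- `diffRep A x` is the number of ordered pairs `(a₁, a₂) ∈ A × A` with `x = a₁ - a₂`. -/
def diffRep (A : Finset ℤ) (x : ℤ) : ℕ :=
  ((A ×ˢ A).filter fun a => x = a.1 - a.2).card

/-- `A ⊂ ℤ` is a `g`-difference set for `[N] = {1, …, N}`: every `m ∈ [N]` has at least `g`
representations as a difference of two elements of `A`. -/
def IsDiffSetFor (g N : ℕ) (A : Finset ℤ) : Prop :=
  ∀ m : ℤ, 1 ≤ m → m ≤ N → g ≤ diffRep A m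

/-- `eta g N` is the minimum size of a `g`-difference set for `[N]`.  (Infinite sets do not
affect the minimum, since finite ones exist; see `eta_isLeast`.) -/
noncomputable def eta (g N : ℕ) : ℕ :=
  sInf {k : ℕ | ∃ A : Finset ℤ, IsDiffSetFor g N A ∧ A.card = k}

/-- The infimum defining `eta` is an attained minimum. -/
theorem eta_isLeast (g N : ℕ) :
    IsLeast {k : ℕ | ∃ A : Finset ℤ, IsDiffSetFor g N A ∧ A.card = k} (eta g N) := by
  have hne : {k : ℕ | ∃ A : Finset ℤ, IsDiffSetFor g N A ∧ A.card = k}.Nonempty := by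
    refine ⟨_, Finset.Icc (1 : ℤ) (N + g), ?_, rfl⟩
    intro m hm1 hm2
    have h : ((Finset.Icc (1 : ℤ) g).image fun a => (a + m, a)) ⊆
        ((Finset.Icc (1 : ℤ) (N + g)) ×ˢ (Finset.Icc (1 : ℤ) (N + g))).filter
          fun a => m = a.1 - a.2 := by
      intro p hp
      simp only [Finset.mem_image, Finset.mem_Icc] at hp
      obtain ⟨a, ha, rfl⟩ := hp
      simp only [Finset.mem_filter, Finset.mem_product, Finset.mem_Icc]
      omega
    have hc := Finset.card_le_card h
    rw [Finset.card_image_of_injective _ (fun a b hab => (Prod.ext_iff.mp hab).2)] at hc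
    simpa [diffRep] using hc
  exact ⟨Nat.sInf_mem hne, fun k hk => Nat.sInf_le hk⟩

/-- The autocorrelation integral `(f ⋆ f)(x) = ∫ f(t) f(x + t) dt` of a nonnegative function.
Its values lie in `[0, ∞]`. -/
noncomputable def autocorr (f : ℝ → ℝ≥0) (x : ℝ) : ℝ≥0∞ :=
  ∫⁻ t : ℝ, (f t : ℝ≥0∞) * (f (x + t) : ℝ≥0∞)

/-- The family of nonnegative Lebesgue measurable functions on `ℝ` whose autocorrelation integral
is at least `1` everywhere on `[0, 1]`. -/
def autocorrFamily : Set (ℝ → ℝ≥0) :=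
  {f | AEMeasurable f ∧ ∀ x ∈ Set.Icc (0 : ℝ) 1, 1 ≤ autocorr f x}

/-- `tau` is the infimum of `∫ f` over the family above (a finite number, by `tau_finite`). -/
noncomputable def tau : ℝ :=
  (⨅ f ∈ autocorrFamily, ∫⁻ x : ℝ, (f x : ℝ≥0∞)).toReal

/-- The infimum defining `tau` is finite. -/
theorem tau_finite : (⨅ f ∈ autocorrFamily, ∫⁻ x : ℝ, (f x : ℝ≥0∞)) ≠ ⊤ := by
  have hc : ∀ t : ℝ, (((Set.Icc (0 : ℝ) 2).indicator (fun _ => (1 : ℝ≥0)) t : ℝ≥0) : ℝ≥0∞) =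
      (Set.Icc (0 : ℝ) 2).indicator (fun _ => (1 : ℝ≥0∞)) t := by
    intro t
    by_cases h : t ∈ Set.Icc (0 : ℝ) 2 <;> simp [h]
  have hmem : (Set.Icc (0 : ℝ) 2).indicator (fun _ => (1 : ℝ≥0)) ∈ autocorrFamily := by
    refine ⟨(measurable_const.indicator measurableSet_Icc).aemeasurable, ?_⟩
    intro x hx
    calc (1 : ℝ≥0∞) = ∫⁻ t : ℝ, (Set.Icc (0 : ℝ) 1).indicator (fun _ => (1 : ℝ≥0∞)) t := by
          rw [MeasureTheory.lintegral_indicator measurableSet_Icc]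
          simp
      _ ≤ _ := by
          refine MeasureTheory.lintegral_mono fun t => ?_
          simp only [hc]
          by_cases h : t ∈ Set.Icc (0 : ℝ) 1
          · have h1 : t ∈ Set.Icc (0 : ℝ) 2 := ⟨h.1, by linarith [h.2]⟩
            have h2 : x + t ∈ Set.Icc (0 : ℝ) 2 :=
              ⟨by linarith [h.1, hx.1], by linarith [h.2, hx.2]⟩
            rw [Set.indicator_of_mem h, Set.indicator_of_mem h1, Set.indicator_of_mem h2]
            simp
          · simp [h]
  refine ne_top_of_le_ne_top ?_ (iInf₂_le _ hmem)
  simp only [hc]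
  rw [MeasureTheory.lintegral_indicator measurableSet_Icc]
  simp

end DiffSet

/-! Take `f` in the family with integral at most `T`, where `T` is slightly above `tau`. A random
set of integers containing `i` with probability about `√(g/M) f(i/M)` has about `T √(gM)` elements,
and each difference up to about `M` is represented at least about `g` times on average. An
exponential moment bound controls all these counts at once (`exists_finset_diffRep_ge`). If `M` is a
bounded multiple of `g`, the fluctuation is at most a small multiple of `g`; if the multiple is
large enough, the probabilities do not exceed 1. Since `f` may be unbounded and irregular, it is
first replaced by a sliding average, which keeps the integral, is bounded and uniformly continuous,
and loses only a short piece of `[0, 1]` (`exists_discretization`).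

To reach all large `N` for a fixed `g`, let `C` be a Singer set: at most `p + 1` residues whose
differences cover everything modulo `q = p ^ 2 + p + 1`. If `A` serves `[M]`, then `C + qA` serves
`[qM]` (`eta_le_of_cover`), and its size is about `√q · T √(gM) = T √(g · qM)`. Because `M` may vary
within a constant factor, Bertrand's postulate supplies a suitable `p`; no finer information on
primes is needed.

Thus every `c > tau` is eventually an upper bound (`eventually_eta_div_sqrt_le`), and both claims
follow, the first because `tau` is positive. -/

namespace DiffSet

/-! ### Concentration for independent random subsets -/

/-- Expectation of `F A` for a random subset `A` of `S` that contains each `i ∈ S`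
independently with probability `p i`. -/
noncomputable def bernoulliExp (p : ℤ → ℝ) (S : Finset ℤ) (F : Finset ℤ → ℝ) : ℝ :=
  ∑ A ∈ S.powerset, ((∏ i ∈ A, p i) * ∏ i ∈ S \ A, (1 - p i)) * F A

section bernoulliExp

variable {p : ℤ → ℝ} {S : Finset ℤ}

theorem bernoulliExp_empty (F : Finset ℤ → ℝ) : bernoulliExp p ∅ F = F ∅ := by
  simp [bernoulliExp]

theorem bernoulliExp_insert {a : ℤ} (ha : a ∉ S) (F : Finset ℤ → ℝ) :
    bernoulliExp p (insert a S) F =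
      p a * bernoulliExp p S (fun A => F (insert a A)) + (1 - p a) * bernoulliExp p S F := by
  unfold bernoulliExp
  rw [Finset.sum_powerset_insert ha, add_comm, Finset.mul_sum, Finset.mul_sum]
  congr 1
  · refine Finset.sum_congr rfl fun A hA => ?_
    have hA' : A ⊆ S := Finset.mem_powerset.mp hA
    have haA : a ∉ A := fun h => ha (hA' h)
    rw [Finset.prod_insert haA, Finset.insert_sdiff_insert, Finset.sdiff_insert_of_notMem ha]
    ring
  · refine Finset.sum_congr rfl fun A hA => ?_
    have hA' : A ⊆ S := Finset.mem_powerset.mp hA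
    have haA : a ∉ A := fun h => ha (hA' h)
    rw [Finset.insert_sdiff_of_notMem _ haA, Finset.prod_insert (by simp [ha])]
    ring

theorem bernoulliExp_congr {F G : Finset ℤ → ℝ} (h : ∀ A ⊆ S, F A = G A) :
    bernoulliExp p S F = bernoulliExp p S G :=
  Finset.sum_congr rfl fun A hA => by rw [h A (Finset.mem_powerset.mp hA)]

theorem bernoulliExp_const_mul (c : ℝ) (F : Finset ℤ → ℝ) :
    bernoulliExp p S (fun A => c * F A) = c * bernoulliExp p S F := by
  unfold bernoulliExp
  rw [Finset.mul_sum]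
  exact Finset.sum_congr rfl fun A _ => by ring

theorem bernoulliExp_sub (F G : Finset ℤ → ℝ) :
    bernoulliExp p S (fun A => F A - G A) = bernoulliExp p S F - bernoulliExp p S G := by
  unfold bernoulliExp
  rw [← Finset.sum_sub_distrib]
  exact Finset.sum_congr rfl fun A _ => by ring

theorem bernoulliExp_sum {ι : Type*} (T : Finset ι) (F : ι → Finset ℤ → ℝ) :
    bernoulliExp p S (fun A => ∑ t ∈ T, F t A) = ∑ t ∈ T, bernoulliExp p S (F t) := by
  unfold bernoulliExp
  rw [Finset.sum_comm]
  exact Finset.sum_congr rfl fun A _ => by rw [Finset.mul_sum]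

theorem bernoulliExp_const (c : ℝ) : bernoulliExp p S (fun _ => c) = c := by
  induction S using Finset.induction_on with
  | empty => exact bernoulliExp_empty _
  | insert a S ha ih => rw [bernoulliExp_insert ha, ih]; ring

theorem bernoulliExp_mono (hp : ∀ i, 0 ≤ p i ∧ p i ≤ 1) {F G : Finset ℤ → ℝ}
    (h : ∀ A ⊆ S, F A ≤ G A) : bernoulliExp p S F ≤ bernoulliExp p S G :=
  Finset.sum_le_sum fun A hA => mul_le_mul_of_nonneg_left (h A (Finset.mem_powerset.mp hA))
    (mul_nonneg (Finset.prod_nonneg fun i _ => (hp i).1)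
      (Finset.prod_nonneg fun i _ => by linarith [(hp i).2]))

theorem bernoulliExp_subset {T : Finset ℤ} (hT : T ⊆ S) :
    bernoulliExp p S (fun A => if T ⊆ A then 1 else 0) = ∏ i ∈ T, p i := by
  induction S using Finset.induction_on generalizing T with
  | empty =>
    rw [Finset.subset_empty.mp hT]
    simp [bernoulliExp_empty]
  | insert a S ha ih =>
    rw [bernoulliExp_insert ha]
    by_cases haT : a ∈ T
    · have h0 : bernoulliExp p S (fun A => if T ⊆ A then (1 : ℝ) else 0) = 0 := by
        rw [bernoulliExp_congr (G := fun _ => 0) fun A hA => if_neg fun h => ha (hA (h haT))]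
        exact bernoulliExp_const 0
      have h1 : bernoulliExp p S (fun A => if T ⊆ insert a A then (1 : ℝ) else 0) =
          ∏ i ∈ T.erase a, p i := by
        rw [← ih (Finset.subset_insert_iff.mp hT)]
        simp only [Finset.subset_insert_iff]
      rw [h0, h1, mul_zero, add_zero, Finset.mul_prod_erase _ _ haT]
    · have hTS : T ⊆ S := (Finset.subset_insert_iff_of_notMem haT).mp hT
      simp only [Finset.subset_insert_iff_of_notMem haT]
      rw [ih hTS]
      ring

/-- Exponential moment bound for functions with bounded differences. -/
theorem bernoulliExp_exp_le (hp : ∀ i, 0 ≤ p i ∧ p i ≤ 1) {c : ℝ} (hc : c ≤ 1)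
    {F : Finset ℤ → ℝ} (hF : ∀ a ∈ S, ∀ A ⊆ S, |F (insert a A) - F A| ≤ c) :
    bernoulliExp p S (fun A => Real.exp (F A - bernoulliExp p S F)) ≤
      Real.exp (S.card * c ^ 2) := by
  induction S using Finset.induction_on generalizing F with
  | empty => simp [bernoulliExp_empty]
  | insert a S ha ih =>
    set m₁ := bernoulliExp p S (fun A => F (insert a A)) with hm₁
    set m₀ := bernoulliExp p S F with hm₀
    have hm : bernoulliExp p (insert a S) F = p a * m₁ + (1 - p a) * m₀ :=
      bernoulliExp_insert ha F
    have hd : |m₁ - m₀| ≤ c := by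
      rw [hm₁, hm₀, ← bernoulliExp_sub, abs_le]
      have hb := fun A (hA : A ⊆ S) => abs_le.mp (hF a (Finset.mem_insert_self a S) A
        (hA.trans (Finset.subset_insert a S)))
      constructor
      · rw [← bernoulliExp_const (p := p) (S := S) (-c)]
        exact bernoulliExp_mono hp fun A hA => (hb A hA).1
      · conv_rhs => rw [← bernoulliExp_const (p := p) (S := S) c]
        exact bernoulliExp_mono hp fun A hA => (hb A hA).2
    have i₁ := ih (F := fun A => F (insert a A)) fun b hb A hA => by
      rw [Finset.insert_comm]
      exact hF b (Finset.mem_insert_of_mem hb) _ (Finset.insert_subset_insert a hA)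
    have i₀ := ih (F := F) fun b hb A hA =>
      hF b (Finset.mem_insert_of_mem hb) _ (hA.trans (Finset.subset_insert a S))
    rw [bernoulliExp_insert ha, hm]
    set m := p a * m₁ + (1 - p a) * m₀ with hmdef
    -- Each half is recentred at its own conditional mean, so that the induction hypothesis applies
    -- to it.
    have split : ∀ (H : Finset ℤ → ℝ) (x : ℝ), bernoulliExp p S (fun A => Real.exp (H A - m)) =
        Real.exp (x - m) * bernoulliExp p S (fun A => Real.exp (H A - x)) := by
      intro H x
      rw [← bernoulliExp_const_mul]
      refine bernoulliExp_congr fun A _ => ?_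
      rw [← Real.exp_add]
      congr 1
      ring
    rw [split _ m₁, split F m₀]
    obtain ⟨hp0, hp1⟩ := hp a
    have hq0 : 0 ≤ 1 - p a := by linarith
    have hc0 : 0 ≤ c := (abs_nonneg _).trans hd
    have hdsq : (m₁ - m₀) ^ 2 ≤ c ^ 2 := by
      rw [← sq_abs]
      exact pow_le_pow_left₀ (abs_nonneg _) hd 2
    have key : ∀ x : ℝ, |x| ≤ 1 → Real.exp x ≤ 1 + x + x ^ 2 := fun x hx => by
      linarith [(abs_le.mp (Real.abs_exp_sub_one_sub_id_le hx)).2]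
    have e₁ : m₁ - m = (1 - p a) * (m₁ - m₀) := by rw [hmdef]; ring
    have e₀ : m₀ - m = -(p a * (m₁ - m₀)) := by rw [hmdef]; ring
    have k₁ : Real.exp (m₁ - m) ≤ 1 + (m₁ - m) + (m₁ - m) ^ 2 := by
      refine key _ ?_
      rw [e₁, abs_mul, abs_of_nonneg hq0]
      exact mul_le_one₀ (by linarith) (abs_nonneg _) (hd.trans hc)
    have k₀ : Real.exp (m₀ - m) ≤ 1 + (m₀ - m) + (m₀ - m) ^ 2 := by
      refine key _ ?_
      rw [e₀, abs_neg, abs_mul, abs_of_nonneg hp0]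
      exact mul_le_one₀ hp1 (abs_nonneg _) (hd.trans hc)
    -- A centred two-point variable: the linear terms cancel because `m` is the mean, leaving the
    -- variance `p a * (1 - p a) * (m₁ - m₀) ^ 2`. One element thus costs a factor `exp (c ^ 2)`.
    have hone : p a * Real.exp (m₁ - m) + (1 - p a) * Real.exp (m₀ - m) ≤ Real.exp (c ^ 2) := by
      calc p a * Real.exp (m₁ - m) + (1 - p a) * Real.exp (m₀ - m)
          ≤ p a * (1 + (m₁ - m) + (m₁ - m) ^ 2) +
            (1 - p a) * (1 + (m₀ - m) + (m₀ - m) ^ 2) :=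
            add_le_add (mul_le_mul_of_nonneg_left k₁ hp0) (mul_le_mul_of_nonneg_left k₀ hq0)
        _ = 1 + p a * (1 - p a) * (m₁ - m₀) ^ 2 := by rw [e₁, e₀]; ring
        _ ≤ 1 + 1 * c ^ 2 := by
            gcongr
            nlinarith
        _ ≤ Real.exp (c ^ 2) := by linarith [Real.add_one_le_exp (c ^ 2)]
    calc p a * (Real.exp (m₁ - m) *
            bernoulliExp p S (fun A => Real.exp (F (insert a A) - m₁))) +
          (1 - p a) * (Real.exp (m₀ - m) * bernoulliExp p S (fun A => Real.exp (F A - m₀)))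
        ≤ p a * (Real.exp (m₁ - m) * Real.exp (S.card * c ^ 2)) +
          (1 - p a) * (Real.exp (m₀ - m) * Real.exp (S.card * c ^ 2)) := by gcongr
      _ = (p a * Real.exp (m₁ - m) + (1 - p a) * Real.exp (m₀ - m)) *
          Real.exp (S.card * c ^ 2) := by ring
      _ ≤ Real.exp (c ^ 2) * Real.exp (S.card * c ^ 2) := by gcongr
      _ = Real.exp ((insert a S).card * c ^ 2) := by
          rw [← Real.exp_add, Finset.card_insert_of_notMem ha]
          push_cast
          congr 1
          ring

/-- Simultaneous one-sided concentration for finitely many functions of bounded differences. -/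
theorem exists_subset_forall_sub_le (hp : ∀ i, 0 ≤ p i ∧ p i ≤ 1) {ι : Type*} {T : Finset ι}
    (hT : T.Nonempty) {F : ι → Finset ℤ → ℝ}
    (hF : ∀ t ∈ T, ∀ a ∈ S, ∀ A ⊆ S, |F t (insert a A) - F t A| ≤ 2)
    {l : ℝ} (hl : 0 < l) (hl' : l ≤ 1 / 2) :
    ∃ A ⊆ S, ∀ t ∈ T,
      F t A - bernoulliExp p S (F t) ≤ Real.log T.card / l + 4 * l * S.card := by
  have hTc : (0 : ℝ) < T.card := by exact_mod_cast hT.card_pos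
  -- One sum of exponentials handles all `t` together: some `A` has `W A` at most its mean, and
  -- every single term is at most `W A`. Taking logarithms and dividing by `l` gives the bound.
  set W : Finset ℤ → ℝ :=
    fun A => ∑ t ∈ T, Real.exp (l * F t A - bernoulliExp p S (fun A => l * F t A)) with hW
  have hle : bernoulliExp p S W ≤ T.card * Real.exp (S.card * (2 * l) ^ 2) := by
    rw [hW, bernoulliExp_sum, ← nsmul_eq_mul]
    refine Finset.sum_le_card_nsmul _ _ _ fun t ht => ?_
    refine bernoulliExp_exp_le hp (by linarith) fun a ha A hA => ?_
    rw [← mul_sub, abs_mul, abs_of_pos hl]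
    nlinarith [hF t ht a ha A hA]
  have hex : ∃ A ⊆ S, W A ≤ T.card * Real.exp (S.card * (2 * l) ^ 2) := by
    by_contra! hcon
    have hlt : bernoulliExp p S (fun _ => T.card * Real.exp (S.card * (2 * l) ^ 2)) <
        bernoulliExp p S W := by
      -- Equality of the means would force every weight to vanish, against total mass 1.
      refine lt_of_le_of_ne (bernoulliExp_mono hp fun A hA => (hcon A hA).le) fun heq => ?_
      have hz : ∀ A ∈ S.powerset,
          ((∏ i ∈ A, p i) * ∏ i ∈ S \ A, (1 - p i)) = 0 := by
        have hsum : bernoulliExp p S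
            (fun A => W A - T.card * Real.exp (S.card * (2 * l) ^ 2)) = 0 := by
          rw [bernoulliExp_sub, heq, sub_self]
        intro A hA
        have hnn : ∀ A ∈ S.powerset, 0 ≤ ((∏ i ∈ A, p i) * ∏ i ∈ S \ A, (1 - p i)) *
            (W A - T.card * Real.exp (S.card * (2 * l) ^ 2)) := fun A hA =>
          mul_nonneg (mul_nonneg (Finset.prod_nonneg fun i _ => (hp i).1)
            (Finset.prod_nonneg fun i _ => by linarith [(hp i).2]))
            (by linarith [hcon A (Finset.mem_powerset.mp hA)])
        have := (Finset.sum_eq_zero_iff_of_nonneg hnn).mp hsum A hA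
        rcases mul_eq_zero.mp this with h | h
        · exact h
        · linarith [hcon A (Finset.mem_powerset.mp hA)]
      have h1 : bernoulliExp p S (fun _ => 1) = 1 := bernoulliExp_const 1
      have h0 : bernoulliExp p S (fun _ => 1) = 0 :=
        Finset.sum_eq_zero fun A hA => by rw [hz A hA, zero_mul]
      linarith
    rw [bernoulliExp_const] at hlt
    linarith
  obtain ⟨A, hA, hWA⟩ := hex
  refine ⟨A, hA, fun t ht => ?_⟩
  have h1 : Real.exp (l * F t A - bernoulliExp p S (fun A => l * F t A)) ≤ W A :=
    Finset.single_le_sum (f := fun t =>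
      Real.exp (l * F t A - bernoulliExp p S (fun A => l * F t A)))
      (fun _ _ => (Real.exp_pos _).le) ht
  have h2 := h1.trans hWA
  rw [← Real.exp_log hTc, ← Real.exp_add, Real.exp_le_exp,
    bernoulliExp_const_mul, ← mul_sub] at h2
  rw [div_add' _ _ _ hl.ne', le_div_iff₀ hl]
  nlinarith

end bernoulliExp

/-! ### Difference counts of a random set -/

theorem diffRep_eq_sum {A S : Finset ℤ} (hA : A ⊆ S) (k : ℤ) :
    (diffRep A k : ℝ) = ∑ i ∈ S, if {i, i + k} ⊆ A then (1 : ℝ) else 0 := by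
  rw [Finset.sum_boole, diffRep]
  congr 1
  refine Finset.card_bij (fun a _ => a.2) ?_ ?_ ?_
  · rintro ⟨a, b⟩ h
    simp only [Finset.mem_filter, Finset.mem_product] at h
    obtain ⟨⟨ha, hb⟩, rfl⟩ := h
    simp [Finset.insert_subset_iff, hb, ha, hA hb]
  · rintro ⟨a, b⟩ h ⟨a', b'⟩ h' heq
    simp only [Finset.mem_filter, Finset.mem_product] at h h' heq
    ext <;> simp <;> omega
  · intro b hb
    simp only [Finset.mem_filter, Finset.insert_subset_iff, Finset.singleton_subset_iff] at hb
    exact ⟨(b + k, b), by simp [hb.2.1, hb.2.2], rfl⟩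

/-- A new element `a` can only add the pairs `(a, a - k)` and `(a + k, a)`. -/
theorem diffRep_insert_le (A : Finset ℤ) (a k : ℤ) :
    |(diffRep (insert a A) k : ℝ) - diffRep A k| ≤ 2 := by
  have h1 : diffRep A k ≤ diffRep (insert a A) k :=
    Finset.card_le_card (Finset.filter_subset_filter _
      (Finset.product_subset_product (Finset.subset_insert _ _) (Finset.subset_insert _ _)))
  have h2 : diffRep (insert a A) k ≤ diffRep A k + 2 := by
    have hsub : ((insert a A ×ˢ insert a A).filter fun x => k = x.1 - x.2) ⊆
        ((A ×ˢ A).filter fun x => k = x.1 - x.2) ∪ {(a, a - k), (a + k, a)} := by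
      rintro ⟨x, y⟩ h
      simp only [Finset.mem_filter, Finset.mem_product, Finset.mem_insert] at h
      simp only [Finset.mem_union, Finset.mem_filter, Finset.mem_product, Finset.mem_insert,
        Finset.mem_singleton, Prod.mk.injEq]
      obtain ⟨⟨hx, hy⟩, hk⟩ := h
      by_cases hxa : x = a
      · right; left; omega
      · by_cases hya : y = a
        · right; right; omega
        · left; tauto
    refine (Finset.card_le_card hsub).trans ((Finset.card_union_le _ _).trans ?_)
    exact Nat.add_le_add_left Finset.card_le_two _
  have h1' : (diffRep A k : ℝ) ≤ diffRep (insert a A) k := by exact_mod_cast h1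
  have h2' : (diffRep (insert a A) k : ℝ) ≤ diffRep A k + 2 := by exact_mod_cast h2
  rw [abs_le]
  constructor <;> linarith

/-- A random set with prescribed densities: cardinality and difference representations
are close to their means. -/
theorem exists_finset_diffRep_ge {p : ℤ → ℝ} (hp : ∀ i, 0 ≤ p i ∧ p i ≤ 1) (S S' : Finset ℤ)
    (hS : S' ⊆ S) (M : ℕ) (hM : ∀ k : ℤ, 1 ≤ k → k ≤ M → ∀ i ∈ S', i + k ∈ S)
    {l : ℝ} (hl : 0 < l) (hl' : l ≤ 1 / 2) :
    ∃ A : Finset ℤ,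
      (A.card : ℝ) ≤ ∑ i ∈ S, p i + (Real.log (M + 1) / l + 4 * l * S.card) ∧
      ∀ k : ℤ, 1 ≤ k → k ≤ M →
        ∑ i ∈ S', p i * p (i + k) - (Real.log (M + 1) / l + 4 * l * S.card) ≤ diffRep A k := by
  classical
  -- index `0` stands for the cardinality, index `k ≥ 1` for the difference `k`
  set F : ℕ → Finset ℤ → ℝ := fun k A => if k = 0 then (A.card : ℝ) else -(diffRep A k : ℝ) with hF
  have hbd : ∀ k ∈ Finset.range (M + 1), ∀ a ∈ S, ∀ A ⊆ S, |F k (insert a A) - F k A| ≤ 2 := by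
    intro k _ a _ A _
    simp only [hF]
    split_ifs
    · have h1 : (A.card : ℝ) ≤ (insert a A).card := by
        exact_mod_cast Finset.card_le_card (Finset.subset_insert _ _)
      have h2 : ((insert a A).card : ℝ) ≤ A.card + 1 := by
        exact_mod_cast Finset.card_insert_le _ _
      rw [abs_le]
      constructor <;> linarith
    · rw [← neg_sub', abs_neg]
      exact diffRep_insert_le A a k
  obtain ⟨A, hA, h⟩ := exists_subset_forall_sub_le hp (S := S) (T := Finset.range (M + 1))
    ⟨0, by simp⟩ hbd hl hl'
  rw [Finset.card_range] at h
  push_cast at h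
  refine ⟨A, ?_, fun k hk1 hkM => ?_⟩
  · have h0 := h 0 (by simp)
    have hE : bernoulliExp p S (F 0) = ∑ i ∈ S, p i := by
      have : bernoulliExp p S (F 0) =
          bernoulliExp p S (fun A => ∑ i ∈ S, if {i} ⊆ A then (1 : ℝ) else 0) := by
        refine bernoulliExp_congr fun A hA => ?_
        simp only [hF, if_true, Finset.singleton_subset_iff, Finset.sum_boole]
        rw [Finset.filter_mem_eq_inter, Finset.inter_eq_right.mpr hA]
      rw [this, bernoulliExp_sum]
      refine Finset.sum_congr rfl fun i hi => ?_
      rw [bernoulliExp_subset (by simpa using hi), Finset.prod_singleton]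
    rw [hE] at h0
    simp only [hF, if_true] at h0
    linarith
  · lift k to ℕ using by omega
    have hk0 : k ≠ 0 := by omega
    have hk := h k (by simp; omega)
    -- Only pairs starting in `S'` are kept: for them `i + k` stays in `S`, and `k ≠ 0` makes the
    -- two memberships independent.
    have hE : bernoulliExp p S (F k) ≤ -∑ i ∈ S', p i * p (i + k) := by
      have h1 : bernoulliExp p S (F k) ≤ bernoulliExp p S
          (fun A => (-1) * ∑ i ∈ S', if {i, i + (k : ℤ)} ⊆ A then (1 : ℝ) else 0) := by
        refine bernoulliExp_mono hp fun A hA => ?_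
        simp only [hF, if_neg hk0, diffRep_eq_sum hA]
        rw [neg_one_mul, neg_le_neg_iff]
        exact Finset.sum_le_sum_of_subset_of_nonneg hS fun i _ _ => by split_ifs <;> norm_num
      refine h1.trans (le_of_eq ?_)
      rw [bernoulliExp_const_mul, bernoulliExp_sum, neg_one_mul]
      congr 1
      refine Finset.sum_congr rfl fun i hi => ?_
      rw [bernoulliExp_subset, Finset.prod_pair (by omega)]
      simp only [Finset.insert_subset_iff, Finset.singleton_subset_iff]
      exact ⟨hS hi, hM k hk1 hkM i hi⟩
    simp only [hF, if_neg hk0] at hk hE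
    linarith

/-! ### Singer sets and the blow-up -/

/-- Singer's construction: for a prime `p` there is a set of at most `p + 1` residues whose
differences cover all residues modulo `p ^ 2 + p + 1`. -/
theorem exists_singer_cover (p : ℕ) [hp : Fact p.Prime] :
    ∃ C : Finset ℤ, (∀ c ∈ C, 0 ≤ c ∧ c < ((p ^ 2 + p + 1 : ℕ) : ℤ)) ∧ C.card ≤ p + 1 ∧
      ∀ m : ℤ, ∃ c₁ ∈ C, ∃ c₂ ∈ C, ((p ^ 2 + p + 1 : ℕ) : ℤ) ∣ m - (c₁ - c₂) := by
  classical
  set q := p ^ 2 + p + 1 with hq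
  have hp2 : 2 ≤ p := hp.out.two_le
  let K := GaloisField p 3
  let _ : Fintype K := Fintype.ofFinite K
  have hfin : Module.finrank (ZMod p) K = 3 := GaloisField.finrank p (by norm_num)
  have hcardK : Fintype.card K = p ^ 3 := by
    rw [← Nat.card_eq_fintype_card]; exact GaloisField.card p 3 (by norm_num)
  obtain ⟨γ, hγ⟩ := IsCyclic.exists_monoid_generator (α := Kˣ)
  have hord : orderOf γ = q * (p - 1) := by
    have h1 : orderOf γ = Nat.card Kˣ := orderOf_eq_card_of_forall_mem_powers hγ
    rw [h1, Nat.card_eq_fintype_card, Fintype.card_units, hcardK, hq]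
    obtain ⟨r, rfl⟩ : ∃ r, p = r + 1 := ⟨p - 1, by omega⟩
    simp only [Nat.add_sub_cancel]
    have : (r + 1) ^ 3 = ((r + 1) ^ 2 + (r + 1) + 1) * r + 1 := by ring
    omega
  let b := Module.finBasisOfFinrankEq (ZMod p) K hfin
  -- Exponents of `γ` modulo `q` are the points of the projective plane over `ZMod p`, and the
  -- kernel of `φ` is a line in it. Its points form the required set.
  let φ : K →ₗ[ZMod p] ZMod p := b.coord 0
  have hφ1 : φ (b 0) = 1 := by simp [φ]
  -- `γ ^ q` is a scalar
  obtain ⟨n, hn⟩ : ∃ n : ℤ, (n : K) = ((γ : K) ^ q) := by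
    have h : ((γ : K) ^ q) ∈ (⊥ : Subfield K) := by
      rw [Subfield.mem_bot_iff_pow_eq_self K p]
      have h1 : ((γ : K) ^ q) ^ (p - 1) = 1 := by
        rw [← pow_mul, ← hord, ← Units.val_pow_eq_pow_val, pow_orderOf_eq_one, Units.val_one]
      calc ((γ : K) ^ q) ^ p = ((γ : K) ^ q) ^ (p - 1 + 1) := by
            rw [Nat.sub_add_cancel (by omega)]
        _ = (γ : K) ^ q := by rw [pow_succ, h1, one_mul]
    rw [mem_bot_iff_intCast p K] at h
    exact h
  have hn0 : (n : ZMod p) ≠ 0 := by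
    intro h
    have : (n : K) = 0 := by rw [← map_intCast (algebraMap (ZMod p) K), h, map_zero]
    rw [hn] at this
    exact pow_ne_zero q γ.ne_zero this
  have hscal : ∀ (x : K) (j : ℕ), φ (((γ : K) ^ q) ^ j * x) = (n : ZMod p) ^ j * φ x := by
    intro x j
    have : ((γ : K) ^ q) ^ j * x = (n ^ j) • x := by
      rw [← hn, zsmul_eq_mul]; push_cast; rfl
    rw [this, map_zsmul, zsmul_eq_mul]
    push_cast
    rfl
  have hred : ∀ c j : ℕ, φ ((γ : K) ^ (c + q * j)) = 0 ↔ φ ((γ : K) ^ c) = 0 := by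
    intro c j
    rw [pow_add, mul_comm, pow_mul, hscal]
    simp [hn0]
  have hmod : ∀ a : ℕ, φ ((γ : K) ^ a) = 0 → φ ((γ : K) ^ (a % q)) = 0 := by
    intro a ha
    rw [← hred (a % q) (a / q), Nat.mod_add_div]
    exact ha
  have hqpos : 0 < q := by omega
  set D : Finset ℕ := (Finset.range q).filter fun a => φ ((γ : K) ^ a) = 0 with hD
  have hDcard : D.card ≤ p + 1 := by
    have hker : (Finset.univ.filter fun x : K => φ x = 0).card = p ^ 2 := by
      have hrk : Module.finrank (ZMod p) (LinearMap.ker φ) = 2 := by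
        have h1 := LinearMap.finrank_range_add_finrank_ker φ
        have h2 : LinearMap.range φ = ⊤ := by
          rw [LinearMap.range_eq_top]
          intro y
          exact ⟨y • b 0, by rw [map_smul, hφ1, smul_eq_mul, mul_one]⟩
        rw [h2, finrank_top, Module.finrank_self, hfin] at h1
        omega
      have h3 : Nat.card (LinearMap.ker φ) = p ^ 2 := by
        rw [Module.natCard_eq_pow_finrank (K := ZMod p), hrk, Nat.card_zmod]
      rw [← h3, ← Fintype.card_subtype, ← Nat.card_eq_fintype_card]
      rfl
    -- Each point of the line accounts for `p - 1` nonzero vectors of the kernel, which has `p ^ 2 -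
    -- 1 = (p + 1) * (p - 1)` of them.
    have hle : (D ×ˢ Finset.range (p - 1)).card ≤
        ((Finset.univ.filter fun x : K => φ x = 0).erase 0).card := by
      refine Finset.card_le_card_of_injOn (fun x => (γ : K) ^ (x.1 + q * x.2)) ?_ ?_
      · rintro ⟨c, j⟩ h
        simp only [hD, Finset.coe_product, Set.mem_prod, Finset.mem_coe, Finset.mem_filter] at h
        simp only [Finset.mem_coe, Finset.mem_erase, Finset.mem_filter, Finset.mem_univ, true_and]
        exact ⟨pow_ne_zero _ γ.ne_zero, (hred c j).mpr h.1.2⟩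
      · rintro ⟨c, j⟩ h ⟨c', j'⟩ h' heq
        simp only [hD, Finset.coe_product, Set.mem_prod, Finset.mem_coe, Finset.mem_filter,
          Finset.mem_range] at h h'
        have hlt : ∀ c j : ℕ, c < q → j < p - 1 → c + q * j < orderOf γ := by
          intro c j hc hj
          rw [hord]
          calc c + q * j < q + q * j := by omega
            _ = q * (j + 1) := by ring
            _ ≤ q * (p - 1) := Nat.mul_le_mul_left q hj
        have heq' : γ ^ (c + q * j) = γ ^ (c' + q * j') := by
          ext
          simpa using heq
        have := pow_injOn_Iio_orderOf (hlt c j h.1.1 h.2) (hlt c' j' h'.1.1 h'.2) heq'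
        have hc : c = c' := by
          have h3 := congrArg (· % q) this
          simpa [Nat.add_mul_mod_self_left, Nat.mod_eq_of_lt h.1.1,
            Nat.mod_eq_of_lt h'.1.1] using h3
        subst hc
        have : q * j = q * j' := by omega
        rw [Nat.eq_of_mul_eq_mul_left hqpos this]
    rw [Finset.card_product, Finset.card_range, Finset.card_erase_of_mem (by simp), hker] at hle
    obtain ⟨r, rfl⟩ : ∃ r, p = r + 1 := ⟨p - 1, by omega⟩
    have h4 : (r + 1) ^ 2 - 1 = (r + 1 + 1) * r := by
      have : (r + 1) ^ 2 = (r + 1 + 1) * r + 1 := by ring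
      omega
    rw [h4, Nat.add_sub_cancel] at hle
    exact Nat.le_of_mul_le_mul_right hle (by omega)
  refine ⟨D.image (fun a : ℕ => (a : ℤ)), ?_, Finset.card_image_le.trans hDcard, ?_⟩
  · intro c hc
    obtain ⟨a, ha, rfl⟩ := Finset.mem_image.mp hc
    have := Finset.mem_range.mp (Finset.mem_filter.mp ha).1
    exact ⟨by positivity, by exact_mod_cast this⟩
  · intro m
    -- Two lines of a projective plane meet: two linear conditions in dimension 3 have a common zero
    -- `v ≠ 0`. Writing `v = γ ^ a` and `γ ^ m * v = γ ^ c` gives `m ≡ c - a` modulo `q`.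
    let ψ : K →ₗ[ZMod p] ZMod p × ZMod p :=
      φ.prod (φ ∘ₗ LinearMap.mulLeft (ZMod p) ((γ ^ m : Kˣ) : K))
    have hψ : LinearMap.ker ψ ≠ ⊥ := by
      refine LinearMap.ker_ne_bot_of_finrank_lt ?_
      rw [hfin, Module.finrank_prod, Module.finrank_self]
      norm_num
    obtain ⟨v, hv, hv0⟩ := (Submodule.ne_bot_iff _).mp hψ
    have hv' : φ v = 0 ∧ φ (((γ ^ m : Kˣ) : K) * v) = 0 := by
      simpa [ψ, LinearMap.mem_ker, Prod.ext_iff] using hv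
    obtain ⟨a, ha⟩ := Submonoid.mem_powers_iff _ _ |>.mp (hγ (Units.mk0 v hv0))
    obtain ⟨c, hc⟩ := Submonoid.mem_powers_iff _ _ |>.mp (hγ (γ ^ m * Units.mk0 v hv0))
    have hva : φ ((γ : K) ^ a) = 0 := by
      rw [← Units.val_pow_eq_pow_val, ha]; exact hv'.1
    have hvc : φ ((γ : K) ^ c) = 0 := by
      rw [← Units.val_pow_eq_pow_val, hc]; exact hv'.2
    have hmem : ∀ a : ℕ, φ ((γ : K) ^ a) = 0 →
        ((a % q : ℕ) : ℤ) ∈ D.image (fun a : ℕ => (a : ℤ)) := fun a ha =>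
      Finset.mem_image_of_mem _ (Finset.mem_filter.mpr
        ⟨Finset.mem_range.mpr (Nat.mod_lt a hqpos), hmod a ha⟩)
    refine ⟨_, hmem c hvc, _, hmem a hva, ?_⟩
    have hmac : (q : ℤ) ∣ m + a - c := by
      have h1 : γ ^ (m + a) = γ ^ (c : ℤ) := by
        rw [zpow_add, zpow_natCast, zpow_natCast, ha, hc]
      have h2 := (zpow_eq_zpow_iff_modEq.mp h1).symm.dvd
      rw [hord] at h2
      exact (Dvd.intro _ (by push_cast; rfl)).trans h2
    have e1 : ((a % q : ℕ) : ℤ) = a - q * ((a / q : ℕ) : ℤ) := by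
      have := Nat.mod_add_div a q
      zify at this
      push_cast
      linarith
    have e2 : ((c % q : ℕ) : ℤ) = c - q * ((c / q : ℕ) : ℤ) := by
      have := Nat.mod_add_div c q
      zify at this
      push_cast
      linarith
    rw [e1, e2]
    obtain ⟨t, ht⟩ := hmac
    exact ⟨t + ((c / q : ℕ) : ℤ) - ((a / q : ℕ) : ℤ), by linear_combination ht⟩

theorem diffRep_le_card (A : Finset ℤ) (k : ℤ) : diffRep A k ≤ A.card := by
  refine Finset.card_le_card_of_injOn Prod.snd ?_ ?_
  · intro x hx
    exact (Finset.mem_product.mp (Finset.mem_filter.mp (Finset.mem_coe.mp hx)).1).2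
  · rintro ⟨a, b⟩ h ⟨a', b'⟩ h' heq
    simp only [Finset.coe_filter, Set.mem_ofPred_eq] at h h' heq
    ext <;> simp <;> omega

/-- Needed for the blow-up, where the quotient of a difference by `q` may be 0, a value outside the
range of `IsDiffSetFor`. -/
theorem diffRep_zero (A : Finset ℤ) : diffRep A 0 = A.card := by
  refine le_antisymm (diffRep_le_card A 0) ?_
  refine Finset.card_le_card_of_injOn (fun a => (a, a)) ?_ ?_
  · intro a ha
    simpa using ha
  · intro a _ b _ h
    exact (Prod.ext_iff.mp h).1

/-- Blowing up a difference set by a set whose differences cover all residues. -/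
theorem eta_le_of_cover {g N M q : ℕ} (hM : 1 ≤ M) (hN : N ≤ q * M) {A C : Finset ℤ}
    (hC : ∀ c ∈ C, 0 ≤ c ∧ c < (q : ℤ))
    (hcov : ∀ m : ℤ, ∃ c₁ ∈ C, ∃ c₂ ∈ C, (q : ℤ) ∣ m - (c₁ - c₂))
    (hA : IsDiffSetFor g M A) : eta g N ≤ C.card * A.card := by
  have hA0 : ∀ k : ℤ, 0 ≤ k → k ≤ M → g ≤ diffRep A k := by
    intro k h0 hk
    rcases h0.eq_or_lt with rfl | h
    · rw [diffRep_zero]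
      exact (hA 1 le_rfl (by exact_mod_cast hM)).trans (diffRep_le_card A 1)
    · exact hA k h hk
  set B : Finset ℤ := (C ×ˢ A).image fun x => x.1 + q * x.2 with hB
  have hBd : IsDiffSetFor g N B := by
    intro m hm1 hmN
    obtain ⟨c₁, h₁, c₂, h₂, k, hk⟩ := hcov m
    obtain ⟨h10, h1q⟩ := hC c₁ h₁
    obtain ⟨h20, h2q⟩ := hC c₂ h₂
    have hq : (0 : ℤ) < q := by omega
    -- Since `|c₁ - c₂| < q` and `1 ≤ m ≤ q * M`, the quotient `k` lies in `[0, M]`, both ends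
    -- included.
    have hN' : (N : ℤ) ≤ q * M := by exact_mod_cast hN
    have hk0 : 0 ≤ k := by
      by_contra! hneg
      have : (q : ℤ) * k ≤ q * (-1) := mul_le_mul_of_nonneg_left (by omega) hq.le
      linarith
    have hkM : k ≤ M := by
      by_contra! hgt
      have : (q : ℤ) * (M + 1) ≤ q * k := mul_le_mul_of_nonneg_left (by omega) hq.le
      linarith
    refine (hA0 k hk0 hkM).trans ?_
    refine Finset.card_le_card_of_injOn (fun x => (c₁ + q * x.1, c₂ + q * x.2)) ?_ ?_
    · rintro ⟨a, b⟩ h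
      simp only [Finset.coe_filter, Set.mem_ofPred_eq, Finset.mem_product] at h
      simp only [Finset.coe_filter, Set.mem_ofPred_eq, Finset.mem_product, hB, Finset.mem_image]
      refine ⟨⟨⟨(c₁, a), ⟨h₁, h.1.1⟩, rfl⟩, ⟨(c₂, b), ⟨h₂, h.1.2⟩, rfl⟩⟩, ?_⟩
      have := h.2
      subst this
      linear_combination hk
    · rintro ⟨a, b⟩ _ ⟨a', b'⟩ _ heq
      simp only [Prod.mk.injEq, add_right_inj, mul_eq_mul_left_iff, hq.ne', or_false] at heq
      exact Prod.ext heq.1 heq.2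
  calc eta g N ≤ B.card := (eta_isLeast g N).2 ⟨B, hBd, rfl⟩
    _ ≤ (C ×ˢ A).card := Finset.card_image_le
    _ = C.card * A.card := Finset.card_product C A

/-! ### Smoothing by sliding averages -/

open MeasureTheory Set

/-- The average of `F` over the interval of length `δ` ending at `t`. -/
noncomputable def slidingAvg (F : ℝ → ℝ≥0∞) (δ t : ℝ) : ℝ≥0∞ :=
  (ENNReal.ofReal δ)⁻¹ * ∫⁻ u in Ioc 0 δ, F (t - u)

section slidingAvg

variable {F : ℝ → ℝ≥0∞} {δ : ℝ}

theorem slidingAvg_eq (F : ℝ → ℝ≥0∞) (δ t : ℝ) :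
    slidingAvg F δ t = (ENNReal.ofReal δ)⁻¹ * ∫⁻ s in Ico (t - δ) t, F s := by
  unfold slidingAvg
  congr 1
  rw [← lintegral_indicator measurableSet_Ioc, ← lintegral_indicator measurableSet_Ico,
    ← lintegral_sub_left_eq_self _ t]
  refine lintegral_congr fun u => ?_
  by_cases h : t - u ∈ Ioc 0 δ
  · have h' : u ∈ Ico (t - δ) t := ⟨by linarith [h.2], by linarith [h.1]⟩
    rw [indicator_of_mem h, indicator_of_mem h', sub_sub_cancel]
  · have h' : u ∉ Ico (t - δ) t := fun h' => h ⟨by linarith [h'.2], by linarith [h'.1]⟩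
    rw [indicator_of_notMem h, indicator_of_notMem h']

theorem measurable_slidingAvg (hF : Measurable F) (δ : ℝ) : Measurable (slidingAvg F δ) :=
  Measurable.const_mul (Measurable.lintegral_prod_right'
    (f := fun z : ℝ × ℝ => F (z.1 - z.2)) (by fun_prop)) _

theorem slidingAvg_le (F : ℝ → ℝ≥0∞) (δ t : ℝ) :
    slidingAvg F δ t ≤ (ENNReal.ofReal δ)⁻¹ * ∫⁻ s, F s := by
  rw [slidingAvg_eq]
  gcongr
  exact Measure.restrict_le_self

theorem lintegral_slidingAvg (hF : Measurable F) (hδ : 0 < δ) :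
    ∫⁻ t, slidingAvg F δ t = ∫⁻ s, F s := by
  have hδ0 : ENNReal.ofReal δ ≠ 0 := by simpa using hδ
  unfold slidingAvg
  rw [lintegral_const_mul _ (Measurable.lintegral_prod_right'
    (f := fun z : ℝ × ℝ => F (z.1 - z.2)) (by fun_prop)),
    lintegral_lintegral_swap (by fun_prop)]
  simp only [lintegral_sub_right_eq_self]
  rw [setLIntegral_const, Real.volume_Ioc, sub_zero, mul_comm, mul_assoc,
    ENNReal.mul_inv_cancel hδ0 ENNReal.ofReal_ne_top, mul_one]

/-- Uniform continuity, from absolute continuity of the integral: moving the window by less than `ρ`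
adds only a set of measure at most `2ρ`. -/
theorem slidingAvg_le_add (hF : ∫⁻ s, F s ≠ ∞) (hδ : 0 < δ) {ε : ℝ≥0∞} (hε : ε ≠ 0) :
    ∃ ρ > 0, ∀ t t' : ℝ, |t - t'| < ρ → slidingAvg F δ t ≤ slidingAvg F δ t' + ε := by
  have hδ0 : ENNReal.ofReal δ ≠ 0 := by simpa using hδ
  obtain ⟨r, hr, hrF⟩ := exists_pos_setLIntegral_lt_of_measure_lt hF
    (ε := ENNReal.ofReal δ * ε) (mul_ne_zero hδ0 hε)
  obtain ⟨ρ, hρ, hρr⟩ : ∃ ρ : ℝ, 0 < ρ ∧ ENNReal.ofReal (ρ + ρ) < r := by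
    by_cases hrt : r = ∞
    · exact ⟨1, one_pos, hrt ▸ ENNReal.ofReal_lt_top⟩
    · have h0 : 0 < r.toReal := ENNReal.toReal_pos hr.ne' hrt
      refine ⟨r.toReal / 3, by positivity, ?_⟩
      rw [ENNReal.ofReal_lt_iff_lt_toReal (by positivity) hrt]
      linarith
  refine ⟨ρ, hρ, fun t t' htt' => ?_⟩
  obtain ⟨h1, h2⟩ := abs_lt.mp htt'
  set E := Ico (t' - ρ - δ) (t' - δ) ∪ Ico t' (t' + ρ) with hE
  have hEvol : volume E < r := by
    refine lt_of_le_of_lt (measure_union_le _ _) ?_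
    rw [Real.volume_Ico, Real.volume_Ico, ← ENNReal.ofReal_add (by linarith) (by linarith)]
    convert hρr using 2
    ring
  have hsub : Ico (t - δ) t ⊆ Ico (t' - δ) t' ∪ E := by
    intro s hs
    have := hs.1
    have := hs.2
    by_cases c1 : s < t' - δ
    · exact Or.inr (Or.inl ⟨by linarith, c1⟩)
    · by_cases c2 : s < t'
      · exact Or.inl ⟨not_lt.mp c1, c2⟩
      · exact Or.inr (Or.inr ⟨not_lt.mp c2, by linarith⟩)
  rw [slidingAvg_eq, slidingAvg_eq]
  calc (ENNReal.ofReal δ)⁻¹ * ∫⁻ s in Ico (t - δ) t, F s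
      ≤ (ENNReal.ofReal δ)⁻¹ * ((∫⁻ s in Ico (t' - δ) t', F s) + ENNReal.ofReal δ * ε) := by
        gcongr
        exact (lintegral_mono_set hsub).trans ((lintegral_union_le _ _ _).trans
          (add_le_add_right (hrF E hEvol).le _))
    _ = _ := by
        rw [mul_add, ← mul_assoc, ENNReal.inv_mul_cancel hδ0 ENNReal.ofReal_ne_top, one_mul]

/-- By Tonelli, the correlation of the averages at `x` is the mean, over `u` and `v` in `(0, δ]`, of
the correlations of `F` at `x + u - v`. -/
theorem one_le_lintegral_slidingAvg_mul (hF : Measurable F) (hδ : 0 < δ) {x : ℝ}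
    (hx : ∀ y ∈ Icc (x - δ) (x + δ), 1 ≤ ∫⁻ t, F t * F (y + t)) :
    1 ≤ ∫⁻ t, slidingAvg F δ t * slidingAvg F δ (x + t) := by
  have hδ0 : ENNReal.ofReal δ ≠ 0 := by simpa using hδ
  have hc : (ENNReal.ofReal δ)⁻¹ * ENNReal.ofReal δ = 1 :=
    ENNReal.inv_mul_cancel hδ0 ENNReal.ofReal_ne_top
  set c := (ENNReal.ofReal δ)⁻¹
  have hmeas : Measurable fun z : (ℝ × ℝ) × ℝ => F (z.1.1 - z.1.2) * F (x + z.1.1 - z.2) := by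
    fun_prop
  have hpt : ∀ t, slidingAvg F δ t * slidingAvg F δ (x + t) =
      c * c * ∫⁻ u in Ioc 0 δ, ∫⁻ v in Ioc 0 δ, F (t - u) * F (x + t - v) := by
    intro t
    have hi : ∀ u, ∫⁻ v in Ioc 0 δ, F (t - u) * F (x + t - v) =
        F (t - u) * ∫⁻ v in Ioc 0 δ, F (x + t - v) := fun u =>
      lintegral_const_mul _ (by fun_prop)
    simp only [hi]
    rw [lintegral_mul_const _ (by fun_prop)]
    unfold slidingAvg
    ring
  simp only [hpt]
  have hin : ∀ u v : ℝ, u ∈ Ioc 0 δ → v ∈ Ioc 0 δ →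
      1 ≤ ∫⁻ t, F (t - u) * F (x + t - v) := by
    intro u v hu hv
    rw [← lintegral_add_right_eq_self _ u]
    refine (hx (x + u - v) ⟨by linarith [hu.1, hv.2], by linarith [hu.2, hv.1]⟩).trans
      (le_of_eq (lintegral_congr fun t => ?_))
    congr 2 <;> ring
  rw [lintegral_const_mul _ (by
    refine Measurable.lintegral_prod_right' (f := fun z : ℝ × ℝ =>
      ∫⁻ v in Ioc 0 δ, F (z.1 - z.2) * F (x + z.1 - v)) ?_
    exact Measurable.lintegral_prod_right' hmeas)]
  rw [lintegral_lintegral_swap (Measurable.lintegral_prod_right' hmeas).aemeasurable]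
  have hmono : ENNReal.ofReal δ * ENNReal.ofReal δ ≤ ∫⁻ u in Ioc 0 δ, ∫⁻ t,
      ∫⁻ v in Ioc 0 δ, F (t - u) * F (x + t - v) := by
    calc ENNReal.ofReal δ * ENNReal.ofReal δ = ∫⁻ _ in Ioc 0 δ, ENNReal.ofReal δ := by
          rw [setLIntegral_const, Real.volume_Ioc, sub_zero]
      _ ≤ _ := by
          refine setLIntegral_mono' measurableSet_Ioc fun u hu => ?_
          rw [lintegral_lintegral_swap (by fun_prop)]
          calc ENNReal.ofReal δ = ∫⁻ _ in Ioc 0 δ, 1 := by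
                rw [setLIntegral_const, Real.volume_Ioc, sub_zero, one_mul]
            _ ≤ _ := setLIntegral_mono' measurableSet_Ioc fun v hv => hin u v hu hv
  calc (1 : ℝ≥0∞) = c * c * (ENNReal.ofReal δ * ENNReal.ofReal δ) := by
        rw [mul_mul_mul_comm, hc, one_mul]
    _ ≤ _ := by gcongr

end slidingAvg

/-! ### Discretization into cells -/

/-- The cell `[i / M, (i + 1) / M)`. -/
def cell (M : ℕ) (i : ℤ) : Set ℝ := (fun x : ℝ => ⌊x * M⌋) ⁻¹' {i}

section cell

variable {M : ℕ}

theorem measurableSet_cell (M : ℕ) (i : ℤ) : MeasurableSet (cell M i) :=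
  (Int.measurable_floor.comp (measurable_id.mul_const _)) (measurableSet_singleton i)

theorem volume_cell (hM : 0 < M) (i : ℤ) : volume (cell M i) = (M : ℝ≥0∞)⁻¹ := by
  have hM' : (0 : ℝ) < M := by exact_mod_cast hM
  have : cell M i = Ico (i / M : ℝ) ((i + 1) / M) := by
    ext x
    simp only [cell, mem_preimage, mem_singleton_iff, Int.floor_eq_iff, mem_Ico,
      div_le_iff₀ hM', lt_div_iff₀ hM']
  rw [this, Real.volume_Ico, ← sub_div, add_sub_cancel_left, one_div,
    ENNReal.ofReal_inv_of_pos hM', ENNReal.ofReal_natCast]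

theorem abs_sub_le_of_mem_cell (hM : 0 < M) {i : ℤ} {x y : ℝ} (hx : x ∈ cell M i)
    (hy : y ∈ cell M i) : |x - y| ≤ 1 / M := by
  have hM' : (0 : ℝ) < M := by exact_mod_cast hM
  simp only [cell, mem_preimage, mem_singleton_iff, Int.floor_eq_iff] at hx hy
  rw [le_div_iff₀ hM']
  refine le_of_eq_of_le (b := |(x - y) * M|) (by rw [abs_mul, abs_of_pos hM']) (abs_le.mpr ?_)
  constructor <;> nlinarith

theorem add_mem_cell (hM : 0 < M) {i : ℤ} {x : ℝ} (hx : x ∈ cell M i) (k : ℤ) :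
    (k / M : ℝ) + x ∈ cell M (i + k) := by
  have hM' : (M : ℝ) ≠ 0 := by exact_mod_cast hM.ne'
  simp only [cell, mem_preimage, mem_singleton_iff] at hx ⊢
  rw [add_mul, div_mul_cancel₀ _ hM', Int.floor_intCast_add, hx, add_comm]

theorem sum_setLIntegral_cell (M : ℕ) (S : Finset ℤ) (G : ℝ → ℝ≥0∞) :
    ∑ i ∈ S, ∫⁻ t in cell M i, G t = ∫⁻ t in {t : ℝ | ⌊t * M⌋ ∈ S}, G t := by
  rw [← lintegral_biUnion_finset]
  · congr 2
    ext t
    simp [cell]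
  · intro i _ j _ hij
    exact Disjoint.preimage _ (by simpa using hij)
  · exact fun i _ => measurableSet_cell M i

end cell

/-- Continuity from above of the finite measure with density `G`. -/
theorem exists_setLIntegral_compl_le {G : ℝ → ℝ≥0∞}
    (hGi : ∫⁻ t, G t ≠ ∞) {ε : ℝ≥0∞} (hε : 0 < ε) :
    ∃ R : ℕ, ∫⁻ t in (Ico (-R : ℝ) R)ᶜ, G t ≤ ε := by
  have hanti : Antitone fun R : ℕ => (Ico (-R : ℝ) R)ᶜ := by
    intro a b hab
    have : (a : ℝ) ≤ b := by exact_mod_cast hab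
    exact compl_subset_compl.mpr (Ico_subset_Ico (by linarith) this)
  have hint : ⋂ R : ℕ, (Ico (-R : ℝ) R)ᶜ = ∅ := by
    refine eq_empty_of_forall_notMem fun x hx => ?_
    obtain ⟨R, hR⟩ := exists_nat_gt |x|
    have := abs_lt.mp hR
    exact mem_iInter.mp hx R ⟨this.1.le, this.2⟩
  have ht := tendsto_measure_iInter_atTop (μ := volume.withDensity G)
    (s := fun R : ℕ => (Ico (-R : ℝ) R)ᶜ)
    (fun R => measurableSet_Ico.compl.nullMeasurableSet) hanti
    ⟨0, by
      refine ne_top_of_le_ne_top hGi ?_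
      rw [withDensity_apply _ measurableSet_Ico.compl]
      exact setLIntegral_le_lintegral _ _⟩
  rw [hint, measure_empty] at ht
  obtain ⟨R, hR⟩ := (ht.eventually (Iio_mem_nhds hε)).exists
  refine ⟨R, ?_⟩
  rw [← withDensity_apply _ measurableSet_Ico.compl]
  exact hR.le

/-- Passing to a measurable version is harmless because translations preserve null sets; the Tonelli
arguments need it. -/
theorem exists_measurable_lintegral_mul_eq {f : ℝ → ℝ≥0} (hf : AEMeasurable f) :
    ∃ F : ℝ → ℝ≥0∞, Measurable F ∧ ∫⁻ t, F t = ∫⁻ t, (f t : ℝ≥0∞) ∧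
      ∀ x, autocorr f x = ∫⁻ t, F t * F (x + t) := by
  obtain ⟨F, hF, hfF'⟩ := hf
  have hfF : ∀ᵐ t : ℝ, (f t : ℝ≥0∞) = (F t : ℝ≥0∞) := by
    filter_upwards [hfF'] with t ht
    rw [ht]
  refine ⟨fun t => (F t : ℝ≥0∞), hF.coe_nnreal_ennreal,
    (lintegral_congr_ae hfF).symm, fun x => lintegral_congr_ae ?_⟩
  filter_upwards [hfF, (measurePreserving_add_left volume x).quasiMeasurePreserving.ae hfF]
    with t h1 h2
  rw [h1, h2]

/-- Discretization of a function whose autocorrelation is at least `1` on `[0, 1]`. -/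
theorem exists_discretization {f : ℝ → ℝ≥0} (hf : f ∈ autocorrFamily) {T : ℝ} (hT0 : 0 ≤ T)
    (hT : ∫⁻ x : ℝ, (f x : ℝ≥0∞) ≤ ENNReal.ofReal T) {η : ℝ} (hη : 0 < η) (hη1 : η < 1) :
    ∃ (B : ℝ) (R M₀ : ℕ), 0 ≤ B ∧ ∀ M : ℕ, M₀ ≤ M → ∃ w : ℤ → ℝ,
      (∀ i, 0 ≤ w i ∧ w i ≤ B) ∧
      (∀ S : Finset ℤ, ∑ i ∈ S, w i ≤ M * T) ∧
      ∀ k : ℤ, 0 ≤ k → (k : ℝ) ≤ (1 - η) * M →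
        (1 - η) * M ≤ ∑ i ∈ Finset.Ico (-(R * M : ℕ) : ℤ) (R * M : ℕ), w i * w (i + k) := by
  obtain ⟨F, hF, hFf, hfF⟩ := exists_measurable_lintegral_mul_eq hf.1
  have hFT : ∫⁻ t, F t ≤ ENNReal.ofReal T := by rwa [hFf]
  have hFa : ∀ x ∈ Icc (0 : ℝ) 1, 1 ≤ ∫⁻ t, F t * F (x + t) := fun x hx =>
    hfF x ▸ hf.2 x hx
  -- Averaging near `x = 0` looks at slightly negative shifts; the autocorrelation is even.
  have hFa' : ∀ x ∈ Icc (-1 : ℝ) 1, 1 ≤ ∫⁻ t, F t * F (x + t) := by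
    intro x hx
    rcases le_total 0 x with h | h
    · exact hFa x ⟨h, hx.2⟩
    · refine (hFa (-x) ⟨by linarith, by linarith [hx.1]⟩).trans (le_of_eq ?_)
      rw [← lintegral_add_left_eq_self _ x]
      refine lintegral_congr fun t => ?_
      rw [neg_add_cancel_left, mul_comm]
  have hFtop : ∫⁻ t, F t ≠ ∞ := ne_top_of_le_ne_top ENNReal.ofReal_ne_top hFT
  set h := slidingAvg F η with hh
  have hhm : Measurable h := measurable_slidingAvg hF η
  have hhT : ∫⁻ t, h t ≤ ENNReal.ofReal T := by rwa [hh, lintegral_slidingAvg hF hη]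
  set B : ℝ := T / η with hB
  have hB0 : 0 ≤ B := by positivity
  have hhB : ∀ t, h t ≤ ENNReal.ofReal B := by
    intro t
    refine (slidingAvg_le F η t).trans ?_
    rw [hB, ENNReal.ofReal_div_of_pos hη, mul_comm, ENNReal.div_eq_inv_mul, mul_comm]
    gcongr
  -- The error budget: `c` bounds both the oscillation of `h` on a cell, which costs `c * T`, and
  -- its mass outside `[-R, R)`, which costs `c * B`.
  set c : ℝ := η / (T + B + 1) with hc
  have hc0 : 0 < c := by positivity
  have hcle : c * (T + B) ≤ η := by
    rw [hc, div_mul_eq_mul_div, div_le_iff₀ (by positivity)]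
    nlinarith
  set e := ENNReal.ofReal c with he
  have he0 : 0 < e := by simpa [he] using hc0
  obtain ⟨ρ, hρ, hρh⟩ := slidingAvg_le_add (δ := η) hFtop hη he0.ne'
  obtain ⟨R, hR⟩ := exists_setLIntegral_compl_le
    (ne_top_of_le_ne_top ENNReal.ofReal_ne_top hhT) he0
  obtain ⟨M₀, hM₀⟩ := exists_nat_gt (1 / ρ)
  refine ⟨B, R, M₀ + 1, hB0, fun M hM => ?_⟩
  have hMpos : 0 < M := by omega
  have hMr : (0 : ℝ) < M := by exact_mod_cast hMpos
  have hM0' : (M : ℝ≥0∞) ≠ 0 := by exact_mod_cast hMpos.ne'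
  have hMtop : (M : ℝ≥0∞) ≠ ∞ := ENNReal.natCast_ne_top M
  have hMρ : 1 / (M : ℝ) < ρ := by
    have h1 : (M₀ : ℝ) < M := by exact_mod_cast hM
    rw [div_lt_iff₀ hMr]
    rw [div_lt_iff₀ hρ] at hM₀
    nlinarith
  -- The mean of `h` over the cell.
  set W : ℤ → ℝ≥0∞ := fun i => M * ∫⁻ t in cell M i, h t with hW
  have hWB : ∀ i, W i ≤ ENNReal.ofReal B := by
    intro i
    calc W i ≤ M * ∫⁻ _ in cell M i, ENNReal.ofReal B := by
          simp only [hW]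
          gcongr
          exact hhB _
      _ = ENNReal.ofReal B := by
          rw [setLIntegral_const, volume_cell hMpos, mul_left_comm,
            ENNReal.mul_inv_cancel hM0' hMtop, mul_one]
  have hWtop : ∀ i, W i ≠ ∞ := fun i => ne_top_of_le_ne_top ENNReal.ofReal_ne_top (hWB i)
  have hWint : ∀ i, ∫⁻ t in cell M i, h t = (M : ℝ≥0∞)⁻¹ * W i := by
    intro i
    simp only [hW]
    rw [← mul_assoc, ENNReal.inv_mul_cancel hM0' hMtop, one_mul]
  have hpt : ∀ i, ∀ s ∈ cell M i, h s ≤ W i + e := by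
    intro i s hs
    calc h s = M * ∫⁻ _ in cell M i, h s := by
          rw [setLIntegral_const, volume_cell hMpos, mul_left_comm,
            ENNReal.mul_inv_cancel hM0' hMtop, mul_one]
      _ ≤ M * ∫⁻ t in cell M i, (h t + e) := by
          gcongr 1
          refine setLIntegral_mono' (measurableSet_cell M i) fun t ht => ?_
          exact hρh s t ((abs_sub_le_of_mem_cell hMpos hs ht).trans_lt hMρ)
      _ = W i + e := by
          rw [lintegral_add_right _ measurable_const, setLIntegral_const, volume_cell hMpos,
            mul_add, mul_left_comm _ e, ENNReal.mul_inv_cancel hM0' hMtop, mul_one]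
  have hsumh : ∀ S : Finset ℤ, ∑ i ∈ S, ∫⁻ t in cell M i, h t ≤ ENNReal.ofReal T := fun S => by
    rw [sum_setLIntegral_cell]
    exact (setLIntegral_le_lintegral _ _).trans hhT
  refine ⟨fun i => (W i).toReal, fun i => ⟨ENNReal.toReal_nonneg, ?_⟩, fun S => ?_, ?_⟩
  · exact ENNReal.toReal_le_of_le_ofReal hB0 (hWB i)
  · rw [← ENNReal.toReal_sum fun i _ => hWtop i]
    refine ENNReal.toReal_le_of_le_ofReal (by positivity) ?_
    simp only [hW]
    rw [← Finset.mul_sum, ENNReal.ofReal_mul hMr.le, ENNReal.ofReal_natCast]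
    gcongr
    exact hsumh S
  · intro k hk0 hkM
    have hkM' : (k / M : ℝ) ≤ 1 - η := by rwa [div_le_iff₀ hMr]
    have hk0' : (0 : ℝ) ≤ k / M := by positivity
    have hone : 1 ≤ ∫⁻ t, h t * h (k / M + t) :=
      one_le_lintegral_slidingAvg_mul hF hη fun y hy =>
        hFa' y ⟨by linarith [hy.1], by linarith [hy.2]⟩
    set S := Finset.Ico (-(R * M : ℕ) : ℤ) (R * M : ℕ) with hS
    have hset : {t : ℝ | ⌊t * M⌋ ∈ S} = Ico (-R : ℝ) R := by
      ext t
      simp only [hS, Finset.mem_Ico, mem_ofPred_eq, mem_Ico, Int.le_floor, Int.floor_lt]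
      push_cast
      rw [← neg_mul, mul_le_mul_iff_left₀ hMr, mul_lt_mul_iff_left₀ hMr]
    -- Translation by `k / M` carries cell `i` into cell `i + k`, where `h` is within `e` above its
    -- mean.
    have hmain : ∫⁻ t in Ico (-R : ℝ) R, h t * h (k / M + t) ≤
        (M : ℝ≥0∞)⁻¹ * (∑ i ∈ S, W i * W (i + k)) + e * ENNReal.ofReal T := by
      rw [← hset, ← sum_setLIntegral_cell]
      calc ∑ i ∈ S, ∫⁻ t in cell M i, h t * h (k / M + t)
          ≤ ∑ i ∈ S, (∫⁻ t in cell M i, h t) * (W (i + k) + e) := by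
            refine Finset.sum_le_sum fun i _ => ?_
            rw [← lintegral_mul_const _ hhm]
            refine setLIntegral_mono' (measurableSet_cell M i) fun t ht => ?_
            gcongr
            exact hpt _ _ (add_mem_cell hMpos ht k)
        _ = (M : ℝ≥0∞)⁻¹ * (∑ i ∈ S, W i * W (i + k)) +
            e * ∑ i ∈ S, ∫⁻ t in cell M i, h t := by
            simp only [mul_add, Finset.sum_add_distrib, Finset.mul_sum]
            congr 1
            · exact Finset.sum_congr rfl fun i _ => by rw [hWint, mul_assoc]
            · exact Finset.sum_congr rfl fun i _ => mul_comm _ _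
        _ ≤ _ := by
            gcongr
            exact hsumh S
    have htail : ∫⁻ t in (Ico (-R : ℝ) R)ᶜ, h t * h (k / M + t) ≤ e * ENNReal.ofReal B := by
      calc ∫⁻ t in (Ico (-R : ℝ) R)ᶜ, h t * h (k / M + t)
          ≤ ∫⁻ t in (Ico (-R : ℝ) R)ᶜ, h t * ENNReal.ofReal B := by
            gcongr
            exact hhB _
        _ = (∫⁻ t in (Ico (-R : ℝ) R)ᶜ, h t) * ENNReal.ofReal B := lintegral_mul_const _ hhm
        _ ≤ _ := by gcongr
    have htot : 1 ≤ (M : ℝ≥0∞)⁻¹ * (∑ i ∈ S, W i * W (i + k)) + ENNReal.ofReal η := by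
      refine hone.trans ?_
      rw [← lintegral_add_compl _ (measurableSet_Ico (a := (-R : ℝ)) (b := R))]
      refine (add_le_add hmain htail).trans ?_
      rw [add_assoc, ← mul_add, ← ENNReal.ofReal_add hT0 hB0, he, ← ENNReal.ofReal_mul hc0.le]
      gcongr
    have hsr : (∑ i ∈ S, W i * W (i + k)) =
        ENNReal.ofReal (∑ i ∈ S, (W i).toReal * (W (i + k)).toReal) := by
      rw [ENNReal.ofReal_sum_of_nonneg fun i _ => by positivity]
      refine Finset.sum_congr rfl fun i _ => ?_
      rw [← ENNReal.toReal_mul, ENNReal.ofReal_toReal (ENNReal.mul_ne_top (hWtop _) (hWtop _))]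
    have hXnn : 0 ≤ ∑ i ∈ S, (W i).toReal * (W (i + k)).toReal :=
      Finset.sum_nonneg fun i _ => by positivity
    rw [hsr, ← ENNReal.ofReal_natCast, ← ENNReal.ofReal_inv_of_pos hMr,
      ← ENNReal.ofReal_mul (by positivity), ← ENNReal.ofReal_add (by positivity) hη.le,
      ENNReal.one_le_ofReal] at htot
    have h3 : 1 - η ≤ (∑ i ∈ S, (W i).toReal * (W (i + k)).toReal) / M := by
      rw [div_eq_inv_mul]
      linarith
    rwa [le_div_iff₀ hMr] at h3

/-! ### Bounds for `tau` and assembly -/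

open MeasureTheory Set Filter

/-- Integrating the autocorrelation over `[0, 1]` gives at least 1, and over the whole line gives
the square of the integral. -/
theorem one_le_lintegral_of_mem_autocorrFamily {f : ℝ → ℝ≥0} (hf : f ∈ autocorrFamily) :
    1 ≤ ∫⁻ x : ℝ, (f x : ℝ≥0∞) := by
  obtain ⟨F, hF, hFf, hfF⟩ := exists_measurable_lintegral_mul_eq hf.1
  rw [← hFf]
  have h1 : (1 : ℝ≥0∞) ≤ (∫⁻ t, F t) * ∫⁻ t, F t := by
    calc (1 : ℝ≥0∞) = ∫⁻ _ in Icc (0 : ℝ) 1, 1 := by simp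
      _ ≤ ∫⁻ x in Icc (0 : ℝ) 1, ∫⁻ t, F t * F (x + t) :=
          setLIntegral_mono' measurableSet_Icc fun x hx => hfF x ▸ hf.2 x hx
      _ ≤ ∫⁻ x, ∫⁻ t, F t * F (x + t) := setLIntegral_le_lintegral _ _
      _ = ∫⁻ t, ∫⁻ x, F t * F (x + t) := lintegral_lintegral_swap (by fun_prop)
      _ = ∫⁻ t, F t * ∫⁻ s, F s := by
          refine lintegral_congr fun t => ?_
          rw [lintegral_const_mul _ (by fun_prop), lintegral_add_right_eq_self]
      _ = _ := lintegral_mul_const _ hF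
  by_contra! hlt
  have h2 : (∫⁻ t, F t) * ∫⁻ t, F t < 1 * 1 := ENNReal.mul_lt_mul hlt hlt
  rw [one_mul] at h2
  exact h1.not_gt h2

theorem one_le_tau : 1 ≤ tau := by
  rw [tau, ← ENNReal.toReal_one]
  exact ENNReal.toReal_mono tau_finite
    (le_iInf₂ fun f hf => one_le_lintegral_of_mem_autocorrFamily hf)

theorem exists_mem_autocorrFamily_lintegral_le {T : ℝ} (hT : tau < T) :
    ∃ f ∈ autocorrFamily, ∫⁻ x : ℝ, (f x : ℝ≥0∞) ≤ ENNReal.ofReal T := by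
  have h : (⨅ f ∈ autocorrFamily, ∫⁻ x : ℝ, (f x : ℝ≥0∞)) < ENNReal.ofReal T :=
    (ENNReal.lt_ofReal_iff_toReal_lt tau_finite).mpr hT
  simp only [iInf_lt_iff] at h
  obtain ⟨f, hf, hlt⟩ := h
  exact ⟨f, hf, hlt.le⟩

theorem IsDiffSetFor.mono {g N N' : ℕ} {A : Finset ℤ} (h : IsDiffSetFor g N A) (hN : N' ≤ N) :
    IsDiffSetFor g N' A :=
  fun m h1 h2 => h m h1 (h2.trans (by exact_mod_cast hN))

/-- Difference sets for `[M]` with `M` comparable to `g`. -/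
theorem exists_isDiffSetFor_of_comparable {f : ℝ → ℝ≥0} (hf : f ∈ autocorrFamily) {T : ℝ}
    (hT0 : 0 ≤ T) (hT : ∫⁻ x : ℝ, (f x : ℝ≥0∞) ≤ ENNReal.ofReal T) {η : ℝ} (hη : 0 < η)
    (hη1 : η < 1) :
    ∃ K : ℕ, 1 ≤ K ∧ ∀ U : ℕ, ∀ᶠ g : ℕ in atTop, ∀ M : ℕ, K * g ≤ M → M ≤ U * g →
      ∃ A : Finset ℤ, IsDiffSetFor g ⌊(1 - η) * M⌋₊ A ∧
        (A.card : ℝ) ≤ T * √(g * ((1 + η) / (1 - η)) * M) + η * g := by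
  obtain ⟨B, R, M₀, hB, hw⟩ := exists_discretization hf hT0 hT hη hη1
  have hη' : 0 < 1 - η := by linarith
  -- This makes the probabilities `w i * s` at most 1 once `M ≥ K * g`. It does not involve `U`,
  -- which may therefore be chosen later in terms of `K`.
  obtain ⟨K, hK⟩ := exists_nat_ge (B ^ 2 * ((1 + η) / (1 - η)))
  refine ⟨K + 1, by omega, fun U => ?_⟩
  -- A constant independent of `g`: the term `4 * l * S.card` is at most half of `η * g`, and the
  -- logarithmic term is `o(g)`.
  set l : ℝ := min (1 / 2) (η / (8 * (2 * R + 1) * (U + 1))) with hl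
  have hl0 : 0 < l := lt_min (by norm_num) (by positivity)
  have hlU : 4 * l * ((2 * R + 1) * U) ≤ η / 2 := by
    have h1 : l ≤ η / (8 * (2 * R + 1) * (U + 1)) := min_le_right _ _
    rw [le_div_iff₀ (by positivity)] at h1
    have : 0 ≤ l * (2 * R + 1) := by positivity
    nlinarith
  have hlog : ∀ᶠ g : ℕ in atTop, Real.log (U * g + 1) ≤ l * η / 2 * g := by
    have hlt : Tendsto (fun g : ℕ => ((U : ℝ) + 1) * g) atTop atTop :=
      tendsto_natCast_atTop_atTop.const_mul_atTop (by positivity)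
    have hpos : 0 < l * η / 2 / (U + 1) := by positivity
    filter_upwards [hlt.eventually (Real.isLittleO_log_id_atTop.bound hpos),
      eventually_ge_atTop 1] with g h1 hg
    have hg' : (1 : ℝ) ≤ g := by exact_mod_cast hg
    have hUg : (0 : ℝ) ≤ U * g := by positivity
    rw [Real.norm_eq_abs, id, Real.norm_of_nonneg (by positivity)] at h1
    calc Real.log (U * g + 1) ≤ Real.log ((U + 1) * g) :=
          Real.log_le_log (by positivity) (by nlinarith)
      _ ≤ _ := le_abs_self _
      _ ≤ _ := h1
      _ = _ := by field_simp
  filter_upwards [hlog, eventually_ge_atTop (M₀ + 1)] with g hg hgM M hKM hMU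
  have hg1 : (1 : ℝ) ≤ g := by exact_mod_cast (by omega : 1 ≤ g)
  have hgM' : g ≤ M := by nlinarith
  have hM0 : (0 : ℝ) < M := by exact_mod_cast (by omega : 0 < M)
  have hMUr : (M : ℝ) ≤ U * g := by exact_mod_cast hMU
  obtain ⟨w, hwB, hwT, hwc⟩ := hw M (by omega)
  -- Inflated so that `(1 - η) * G = g + η * g`; the surplus `η * g` absorbs the fluctuation.
  set G : ℝ := g * ((1 + η) / (1 - η)) with hG
  have hG0 : 0 ≤ G := by positivity
  have hGM : B ^ 2 * G ≤ M := by
    have h1 : ((K : ℝ) + 1) * g ≤ M := by exact_mod_cast hKM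
    calc B ^ 2 * G = (B ^ 2 * ((1 + η) / (1 - η))) * (g : ℝ) := by rw [hG]; ring
      _ ≤ (K : ℝ) * g := by gcongr
      _ ≤ (M : ℝ) := by nlinarith
  set s : ℝ := √(G / M) with hs
  have hs0 : 0 ≤ s := Real.sqrt_nonneg _
  have hss : s * s = G / M := Real.mul_self_sqrt (by positivity)
  have hp : ∀ i, 0 ≤ w i * s ∧ w i * s ≤ 1 := by
    intro i
    refine ⟨mul_nonneg (hwB i).1 hs0, ?_⟩
    refine (mul_le_mul_of_nonneg_right (hwB i).2 hs0).trans ?_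
    refine abs_le_one_iff_mul_self_le_one.mpr ?_ |> le_of_abs_le
    rw [mul_mul_mul_comm, hss, ← sq, ← mul_div_assoc, div_le_one hM0]
    exact hGM
  set L := ⌊(1 - η) * M⌋₊ with hL
  have hLr : (L : ℝ) ≤ (1 - η) * M := Nat.floor_le (by positivity)
  have hLM : L ≤ M := by
    have : (L : ℝ) ≤ M := by nlinarith
    exact_mod_cast this
  set S' := Finset.Ico (-(R * M : ℕ) : ℤ) (R * M : ℕ) with hS'
  -- Longer than `S'` by `M` on the right, to contain `i + k` for `i ∈ S'` and `k ≤ M`.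
  set S := Finset.Ico (-(R * M : ℕ) : ℤ) (R * M + M : ℕ) with hS
  obtain ⟨A, hA, hAr⟩ := exists_finset_diffRep_ge hp S S'
    (Finset.Ico_subset_Ico_right (by push_cast; omega)) L
    (fun k h1 h2 i hi => by
      rw [hS', Finset.mem_Ico] at hi
      rw [hS, Finset.mem_Ico]
      push_cast at hi ⊢
      omega) hl0 (min_le_left _ _)
  have hScard : (S.card : ℝ) = (2 * R + 1) * M := by
    rw [hS, Int.card_Ico, show (((R * M + M : ℕ) : ℤ) - (-(R * M : ℕ) : ℤ)).toNat =
      2 * (R * M) + M by omega]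
    push_cast
    ring
  rw [hScard] at hA hAr
  have hD : Real.log (L + 1) / l + 4 * l * ((2 * R + 1) * M) ≤ η * g := by
    have h1 : Real.log (L + 1) / l ≤ η / 2 * g := by
      rw [div_le_iff₀ hl0]
      calc Real.log (L + 1) ≤ Real.log (U * g + 1) := by
            refine Real.log_le_log (by positivity) ?_
            have : (L : ℝ) ≤ M := by exact_mod_cast hLM
            linarith
        _ ≤ l * η / 2 * g := hg
        _ = _ := by ring
    have h2 : 4 * l * ((2 * R + 1) * M) ≤ η / 2 * g := by
      calc 4 * l * ((2 * R + 1) * M) ≤ 4 * l * ((2 * R + 1) * (U * g)) := by gcongr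
        _ = 4 * l * ((2 * R + 1) * U) * g := by ring
        _ ≤ _ := by gcongr
    linarith
  refine ⟨A, fun k hk1 hkL => ?_, ?_⟩
  · have hkr : (k : ℝ) ≤ (1 - η) * M := le_trans (by exact_mod_cast hkL) hLr
    have h1 := hwc k (by omega) hkr
    have h2 := hAr k hk1 hkL
    have h3 : ∑ i ∈ S', w i * s * (w (i + k) * s) = (∑ i ∈ S', w i * w (i + k)) * (G / M) := by
      rw [← hss, Finset.sum_mul]
      exact Finset.sum_congr rfl fun i _ => by ring
    have h4 : (1 - η) * G ≤ (∑ i ∈ S', w i * w (i + k)) * (G / M) := by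
      calc (1 - η) * G = (1 - η) * M * (G / M) := by field_simp
        _ ≤ _ := by gcongr
    have h5 : (1 - η) * G = g + η * g := by
      rw [hG]
      field_simp
    rw [h3] at h2
    have : (g : ℝ) ≤ diffRep A k := by linarith
    exact_mod_cast this
  · refine hA.trans (add_le_add ?_ hD)
    rw [← Finset.sum_mul]
    calc (∑ i ∈ S, w i) * s ≤ M * T * s := by
          gcongr
          exact hwT _
      _ = T * √(G * M) := by
          have : √(G * M) = s * M := by
            rw [hs, ← Real.sqrt_sq hM0.le, ← Real.sqrt_mul (by positivity),
              Real.sqrt_sq hM0.le]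
            congr 1
            field_simp
          rw [this]
          ring

/-- Bertrand's postulate gives primes `p` with `p ^ 2 + p + 1` in a prescribed range. -/
theorem exists_prime_of_le {W P N : ℕ} (hW : 1 ≤ W) (hP : 1 ≤ P) (hN : 7 * W * P ^ 2 ≤ N) :
    ∃ p : ℕ, p.Prime ∧ P ≤ p ∧ W * (p ^ 2 + p + 1) ≤ N ∧ N ≤ 7 * W * (p ^ 2 + p + 1) := by
  -- Bertrand gives `x < p ≤ 2x`; the 7 comes from `4x² + 2x + 1 ≤ 7x²`.
  set x := Nat.sqrt (N / (7 * W)) with hx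
  have hPx : P ≤ x := by
    rw [hx, Nat.le_sqrt', Nat.le_div_iff_mul_le (by positivity)]
    linarith
  obtain ⟨p, hp, hxp, hp2⟩ := Nat.exists_prime_lt_and_le_two_mul x (by omega)
  have hx2 : 7 * W * x ^ 2 ≤ N := by
    have : x ^ 2 ≤ N / (7 * W) := Nat.sqrt_le' _
    rw [Nat.le_div_iff_mul_le (by positivity)] at this
    linarith
  have hNx : N < 7 * W * (x + 1) ^ 2 := by
    have : N / (7 * W) < (x + 1) ^ 2 := Nat.lt_succ_sqrt' _
    rw [Nat.div_lt_iff_lt_mul (by positivity)] at this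
    linarith
  refine ⟨p, hp, by omega, ?_, ?_⟩
  · refine le_trans ?_ hx2
    have : p ^ 2 + p + 1 ≤ 7 * x ^ 2 := by nlinarith
    calc W * (p ^ 2 + p + 1) ≤ W * (7 * x ^ 2) := by gcongr
      _ = _ := by ring
  · refine hNx.le.trans ?_
    gcongr
    nlinarith

theorem eventually_eta_div_sqrt_le {c : ℝ} (hc : tau < c) :
    ∀ᶠ g : ℕ in atTop, ∀ᶠ N : ℕ in atTop, (eta g N : ℝ) / √((g : ℝ) * N) ≤ c := by
  obtain ⟨T, hτT, hTc⟩ := exists_between hc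
  have hT0 : 0 ≤ T := by linarith [one_le_tau]
  -- The factor collects all later losses; at `η = 0` it equals `T < c`.
  obtain ⟨η, hη, hη2, hηc⟩ : ∃ η : ℝ, 0 < η ∧ η ≤ 1 / 2 ∧
      (1 + η) * (T * ((1 + η) / (1 - η)) + η) ≤ c := by
    have hcont : ContinuousAt (fun η : ℝ => (1 + η) * (T * ((1 + η) / (1 - η)) + η)) 0 := by
      fun_prop (disch := norm_num)
    have h1 : ∀ᶠ η : ℝ in nhds 0, (1 + η) * (T * ((1 + η) / (1 - η)) + η) < c :=
      hcont.eventually_lt_const (by simpa using hTc)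
    have h2 : ∀ᶠ η : ℝ in nhds 0, η < 1 / 2 := Iio_mem_nhds (by norm_num)
    obtain ⟨η, ⟨ha, hb⟩, hη⟩ := (((h1.and h2).filter_mono nhdsWithin_le_nhds).and
      (self_mem_nhdsWithin (s := Ioi (0 : ℝ)))).exists
    exact ⟨η, hη, hb.le, ha.le⟩
  have hη1 : η < 1 := by linarith
  have hη' : 0 < 1 - η := by linarith
  obtain ⟨f, hf, hfT⟩ := exists_mem_autocorrFamily_lintegral_le hτT
  obtain ⟨K, hK, hdense⟩ := exists_isDiffSetFor_of_comparable hf hT0 hfT hη hη1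
  obtain ⟨P, hP⟩ := exists_nat_ge (1 / η)
  -- Below, `L ≤ 7 * (K * g) + 1` and `M ≤ 2 * L`, so `M ≤ 17 * K * g`. The condition `g ≥ 2 * P`
  -- yields `η * Y ≥ 2`.
  filter_upwards [hdense (17 * K), eventually_ge_atTop 1, eventually_ge_atTop (2 * P)]
    with g hg hg1 hgP
  have hKg : 1 ≤ K * g := Nat.mul_pos hK hg1
  filter_upwards [eventually_ge_atTop (7 * (K * g) * (P + 1) ^ 2)] with N hN
  obtain ⟨p, hp, hPp, hqN, hNq⟩ := exists_prime_of_le hKg (by omega) hN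
  set q := p ^ 2 + p + 1 with hq
  have : Fact p.Prime := ⟨hp⟩
  obtain ⟨C, hC, hCcard, hcov⟩ := exists_singer_cover p
  have hqpos : 0 < q := by omega
  set L := N / q + 1 with hL
  have hLlo : K * g ≤ N / q := (Nat.le_div_iff_mul_le hqpos).mpr hqN
  have hLhi : N / q ≤ 7 * (K * g) := Nat.div_le_of_le_mul (by linarith)
  -- Enlarged because the random construction for `M` only serves differences up to `(1 - η) * M`.
  set M := ⌈(L : ℝ) / (1 - η)⌉₊ with hM
  have hMlo : (L : ℝ) ≤ (1 - η) * M := by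
    have := Nat.le_ceil ((L : ℝ) / (1 - η))
    rw [div_le_iff₀ hη'] at this
    linarith
  have hMhi : (M : ℝ) < L / (1 - η) + 1 := Nat.ceil_lt_add_one (by positivity)
  have hLM : L ≤ M := by
    have : (L : ℝ) ≤ M := by nlinarith [(Nat.cast_nonneg M : (0 : ℝ) ≤ M)]
    exact_mod_cast this
  have hM2 : M < 2 * L + 1 := by
    have h1 : (L : ℝ) / (1 - η) ≤ 2 * L := by
      rw [div_le_iff₀ hη']
      nlinarith [(Nat.cast_nonneg L : (0 : ℝ) ≤ L)]
    have : (M : ℝ) < 2 * L + 1 := by linarith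
    exact_mod_cast this
  obtain ⟨A, hA, hAcard⟩ := hg M (by omega) (by rw [mul_assoc]; omega)
  have hNL : N ≤ q * L := (Nat.lt_mul_div_succ N hqpos).le
  have heta := eta_le_of_cover (by omega) hNL hC hcov (hA.mono (Nat.le_floor hMlo))
  have hetaR : (eta g N : ℝ) ≤ (p + 1) * A.card := by
    exact_mod_cast heta.trans (Nat.mul_le_mul_right _ hCcard)
  -- real estimates
  have hqr : (0 : ℝ) < q := by exact_mod_cast hqpos
  have hgr : (1 : ℝ) ≤ g := by exact_mod_cast hg1
  have hηP : 1 ≤ η * P := by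
    rw [div_le_iff₀ hη] at hP
    linarith
  set Y : ℝ := N / q with hY
  have hNY : (N : ℝ) = Y * q := by rw [hY]; field_simp
  have hLY : (L : ℝ) ≤ Y + 1 := by
    rw [hL]
    push_cast
    exact add_le_add_left Nat.cast_div_le _
  have hgY : (g : ℝ) ≤ Y := by
    rw [hY, le_div_iff₀ hqr]
    have h1 : g * q ≤ N := (Nat.mul_le_mul_right q (Nat.le_mul_of_pos_left g hK)).trans hqN
    exact_mod_cast h1
  have hY0 : 0 ≤ Y := by linarith
  have hηY : 2 ≤ η * Y := by
    have h1 : (2 : ℝ) * P ≤ g := by exact_mod_cast hgP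
    calc (2 : ℝ) ≤ η * (2 * P) := by linarith
      _ ≤ η * Y := by
          gcongr
          exact h1.trans hgY
  -- The two roundings, in `L` and in `M`, cost at most 2 in the numerator, which `η * Y ≥ 2`
  -- covers.
  have hMY : (M : ℝ) ≤ (1 + η) / (1 - η) * Y := by
    refine hMhi.le.trans ?_
    rw [div_add_one hη'.ne', div_mul_eq_mul_div]
    gcongr
    linarith
  have hpq : (p : ℝ) + 1 ≤ (1 + η) * √q := by
    have h1 : (p : ℝ) ≤ √q := by
      refine Real.le_sqrt_of_sq_le ?_
      rw [hq]
      push_cast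
      nlinarith [(Nat.cast_nonneg p : (0 : ℝ) ≤ p)]
    have h2 : (1 : ℝ) ≤ η * p := by
      have : (P : ℝ) ≤ p := by exact_mod_cast (by omega : P ≤ p)
      exact hηP.trans (mul_le_mul_of_nonneg_left this hη.le)
    calc (p : ℝ) + 1 ≤ (1 + η) * p := by linarith
      _ ≤ _ := by gcongr
  have hAY : (A.card : ℝ) ≤ (T * ((1 + η) / (1 - η)) + η) * √(g * Y) := by
    have h1 : √(g * ((1 + η) / (1 - η)) * M) ≤ (1 + η) / (1 - η) * √(g * Y) := by
      refine Real.sqrt_le_iff.mpr ⟨by positivity, ?_⟩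
      rw [mul_pow, Real.sq_sqrt (by positivity)]
      calc g * ((1 + η) / (1 - η)) * M ≤
            g * ((1 + η) / (1 - η)) * ((1 + η) / (1 - η) * Y) := by gcongr
        _ = _ := by ring
    -- As `g ≤ Y`, the additive error `η * g` is absorbed into the main term.
    have h2 : (g : ℝ) ≤ √(g * Y) := Real.le_sqrt_of_sq_le (by nlinarith)
    calc (A.card : ℝ) ≤ T * √(g * ((1 + η) / (1 - η)) * M) + η * g := hAcard
      _ ≤ T * ((1 + η) / (1 - η) * √(g * Y)) + η * √(g * Y) := by gcongr
      _ = _ := by ring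
  have hNpos : 0 < (g : ℝ) * N := by
    rw [hNY]
    have : 0 < Y := by linarith
    positivity
  rw [div_le_iff₀ (Real.sqrt_pos.mpr hNpos)]
  have hsq : √((g : ℝ) * N) = √q * √(g * Y) := by
    rw [← Real.sqrt_mul hqr.le, hNY]
    congr 1
    ring
  calc (eta g N : ℝ) ≤ (p + 1) * A.card := hetaR
    _ ≤ ((1 + η) * √q) * ((T * ((1 + η) / (1 - η)) + η) * √(g * Y)) :=
        mul_le_mul hpq hAY (Nat.cast_nonneg _) (mul_nonneg (by linarith) (Real.sqrt_nonneg _))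
    _ = (1 + η) * (T * ((1 + η) / (1 - η)) + η) * √((g : ℝ) * N) := by rw [hsq]; ring
    _ ≤ c * √((g : ℝ) * N) := by gcongr

end DiffSet

theorem theorem5p2 :
    (∀ ε : ℝ, 0 < ε → ε < 1 →
      ∀ᶠ g : ℕ in Filter.atTop, ∀ᶠ N : ℕ in Filter.atTop,
        (DiffSet.eta g N : ℝ) / Real.sqrt ((g : ℝ) * (N : ℝ)) ≤
          (1 + ε) ^ 4 / (1 - ε) * DiffSet.tau) ∧
    Filter.limsup (fun g : ℕ => Filter.limsup (fun N : ℕ =>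
        (((DiffSet.eta g N : ℝ) / Real.sqrt ((g : ℝ) * (N : ℝ)) : ℝ) : EReal))
      Filter.atTop) Filter.atTop ≤ (DiffSet.tau : EReal) := by
  refine ⟨fun ε hε hε1 => DiffSet.eventually_eta_div_sqrt_le ?_, ?_⟩
  · have h1 : 1 < (1 + ε) ^ 4 / (1 - ε) := by
      rw [lt_div_iff₀ (by linarith)]
      have : 1 ≤ (1 + ε) ^ 4 := one_le_pow₀ (by linarith)
      linarith
    -- Positivity of `tau` turns a factor above 1 into a constant strictly above `tau`.
    nlinarith [DiffSet.one_le_tau]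
  · refine EReal.le_of_forall_lt_iff_le.mp fun c hc => ?_
    refine Filter.limsup_le_of_le (by isBoundedDefault) ?_
    filter_upwards [DiffSet.eventually_eta_div_sqrt_le (EReal.coe_lt_coe_iff.mp hc)] with g hg
    refine Filter.limsup_le_of_le (by isBoundedDefault) ?_
    filter_upwards [hg] with N hN
    exact EReal.coe_le_coe_iff.mpr hN
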